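/- **Theorem 1 (First estimate for periodic anisotropic curvature flows).** Let $n\ge 1$ and let $\{\phi^0,\dots,\phi^n\}$ be a basis of $V^*\cong\mathbb R^{n+1}$. Let $F:V^*\to\mathbb R$ be an anisotropic area integrand: $F$ is convex, positive and $C^3$ on $V^*\setminus\{0\}$, $F(\lambda v)=\lambda F(v)$ for all $\lambda>0$, and for every $\lambda>0$ the set $K=\{F\le\lambda\}$ is uniformly convex, i.e. there is $c>0$ such that for all $x,y\in K$ the closed ball of radius $c|x-y|^2$ about $\tfrac{x+y}2$ lies in $K$. Assume that $F$ satisfies the smallness-of-third-derivatives (Cartan tensor) condition $$F(z)^2\,D^3F|_z(p,q,r)\le C_1\Big[F(z)^3\,D^2F|_z(p,p)\,D^2F|_z(q,q)\,D^2F|_z(r,r)\Big]^{1/2}$$ for all $z\ne0$ and all $p,q,r$ tangent at $z$ to the level set of $F$ through $z$ (that is, $DF|_z(p)=DF|_z(q)=DF|_z(r)=0$), with a constant $C_1\ge0$ such that $C_1^2<4/\sqrt n$. Then there are constants $A>0$, $P>0$ and $q>1$ depending only on $F$ (and the fixed basis), and for every $M$ a time $T'>0$ depending only on $M$ (and the fixed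 dimension $n$), such that the following holds. Let $T>0$ and let $u:\mathbb R^n\times[0,T]\to\mathbb R$ be a $C^3$ function with $|u|\le M$ that is spatially periodic, $u(x+\ell,t)=u(x,t)$ for all $\ell$ in some (full-rank) lattice in $\mathbb R^n$, and that solves the graphical anisotropic mean curvature flow $$u_t=\sum_{i,j=1}^n F(z)\,D^2F|_{z}(\phi^i,\phi^j)\,u_{ij},\qquad z=Du-\phi^0:=\sum_{i=1}^n u_i\phi^i-\phi^0 .$$ Then at every $x\in\mathbb R^n$ and every $t$ with $0<t\le \min\{T,T'\}$, $$F(Du-\phi^0)\le\max\left\{t^{q/2}\exp\left(\frac{Aq\,(|u|-2M)^2}{4t}\right),\;P\right\}.$$ -/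

import Mathlib

namespace AnisotropicFlow

noncomputable section

/-- Euclidean space `ℝ^k`. -/
abbrev Euc (k : ℕ) : Type := EuclideanSpace ℝ (Fin k)

/-- A set `K` is uniformly convex: the midpoint of two points `x, y` of `K` is at distance at least
`c |x - y|²` from the complement of `K`, with a fixed `c > 0`. (For a compact body with `C²` boundary
this says that the principal curvatures of the boundary are bounded below by a positive constant.) -/
def IsUniformlyConvexSet {k : ℕ} (K : Set (Euc k)) : Prop :=
  ∃ c : ℝ, 0 < c ∧ ∀ x ∈ K, ∀ y ∈ K,
    Metric.closedBall (midpoint ℝ x y) (c * ‖x - y‖ ^ 2) ⊆ K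

/-- An anisotropic area integrand on `V* ≅ ℝ^k`: positive, convex, `C³` away from the origin,
positively homogeneous of degree one, with uniformly convex sublevel sets `{F ≤ l}`. -/
structure IsAreaIntegrand {k : ℕ} (F : Euc k → ℝ) : Prop where
  pos : ∀ v, v ≠ 0 → 0 < F v
  convex : ConvexOn ℝ Set.univ F
  contDiff : ContDiffOn ℝ 3 F {0}ᶜ
  homog : ∀ (l : ℝ) (v : Euc k), 0 < l → F (l • v) = l * F v
  uniformlyConvex : ∀ l : ℝ, 0 < l → IsUniformlyConvexSet {v | F v ≤ l}

/-- The Hessian `D²F|_z (p, q)`. -/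
def hess {k : ℕ} (F : Euc k → ℝ) (z p q : Euc k) : ℝ :=
  iteratedFDeriv ℝ 2 F z ![p, q]

/-- The tensor `Q_z (p, q, r) = F(z)² D³F|_z (p, q, r)`. -/
def cartanQ {k : ℕ} (F : Euc k → ℝ) (z p q r : Euc k) : ℝ :=
  F z ^ 2 * iteratedFDeriv ℝ 3 F z ![p, q, r]

/-- `p` is tangent at `z` to the level set `{F = F(z)}`. -/
def IsTangent {k : ℕ} (F : Euc k → ℝ) (z p : Euc k) : Prop :=
  fderiv ℝ F z p = 0

/-- Smallness of third derivatives with constant `C₁`: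
`Q_z (p, q, r) ≤ C₁ [F(z)³ D²F|_z(p, p) D²F|_z(q, q) D²F|_z(r, r)]^{1/2}`
for all `z ≠ 0` and all `p, q, r` tangent at `z` to the level set of `F` through `z`. -/
def SmallThirdDerivatives {k : ℕ} (F : Euc k → ℝ) (C₁ : ℝ) : Prop :=
  ∀ z : Euc k, z ≠ 0 → ∀ p q r : Euc k, IsTangent F z p → IsTangent F z q → IsTangent F z r →
    cartanQ F z p q r ≤ C₁ * √(F z ^ 3 * hess F z p p * hess F z q q * hess F z r r)

/-- The `i`-th standard unit vector of `ℝ^n`. -/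
def unitVec {n : ℕ} (i : Fin n) : Euc n := EuclideanSpace.single i 1

/-- The spatial derivative `u_i (x, t)`. -/
def partialX {n : ℕ} (u : Euc n → ℝ → ℝ) (x : Euc n) (t : ℝ) (i : Fin n) : ℝ :=
  fderiv ℝ (fun y => u y t) x (unitVec i)

/-- The second spatial derivative `u_ij (x, t) = D²u (e_i, e_j)`. -/
def partialXX {n : ℕ} (u : Euc n → ℝ → ℝ) (x : Euc n) (t : ℝ) (i j : Fin n) : ℝ :=
  iteratedFDeriv ℝ 2 (fun y => u y t) x ![unitVec i, unitVec j]

/-- The conormal `Du - φ⁰ = ∑_{i=1}^n u_i φ^i - φ⁰` of the graph of `u(·, t)` at `x`,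
for a basis `φ⁰, …, φⁿ` of `V* ≅ ℝ^{n+1}`. -/
def conormal {n : ℕ} (φ : Module.Basis (Fin (n + 1)) ℝ (Euc (n + 1))) (u : Euc n → ℝ → ℝ)
    (x : Euc n) (t : ℝ) : Euc (n + 1) :=
  (∑ i : Fin n, partialX u x t i • φ i.succ) - φ 0

/-- `u` is a `C³` solution on `ℝ^n × [0, T]` (one-sided time derivatives at the ends) of
`u_t = F D²F|_{Du - φ⁰} (φ^i, φ^j) u_ij`. -/
structure IsSolution {n : ℕ} (φ : Module.Basis (Fin (n + 1)) ℝ (Euc (n + 1)))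
    (F : Euc (n + 1) → ℝ) (T : ℝ) (u : Euc n → ℝ → ℝ) : Prop where
  contDiff : ContDiffOn ℝ 3 (fun z : Euc n × ℝ => u z.1 z.2) (Set.univ ×ˢ Set.Icc 0 T)
  equation : ∀ x : Euc n, ∀ t ∈ Set.Icc 0 T,
    HasDerivWithinAt (fun s => u x s)
      (∑ i : Fin n, ∑ j : Fin n,
        F (conormal φ u x t) * hess F (conormal φ u x t) (φ i.succ) (φ j.succ)
          * partialXX u x t i j)
      (Set.Icc 0 T) t

/-- `u` is spatially periodic on `ℝ^n × [0, T]` with respect to some full-rank lattice of `ℝ^n`. -/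
def IsSpatiallyPeriodic {n : ℕ} (T : ℝ) (u : Euc n → ℝ → ℝ) : Prop :=
  ∃ (L : Submodule ℤ (Euc n)) (_ : DiscreteTopology L) (_ : IsZLattice ℝ L),
    ∀ l ∈ L, ∀ x : Euc n, ∀ t ∈ Set.Icc 0 T, u (x + l) t = u x t

end

end AnisotropicFlow

/-! The gradient bound is obtained by doubling of variables: `u (x + s e, t) - u (x, t)` is compared
with a concave logarithmic barrier in `s` that translates in `t`. At an interior maximum the gradients
at `x` and `x + s e` agree, so the coefficients of the equation are evaluated at the same conormal and
only their ellipticity enters, which follows from uniform convexity and homogeneity of `F`; the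
smallness of third derivatives is not needed. -/

namespace AnisotropicFlow

open Filter Topology

/-! For a unit vector `e`, compare u(x+se,t) - u(x,t) with Θ(s) + 2M(1 - t/t₀), where Θ(s) =
log(1+Gs)/b satisfies Θ'' = -bΘ'². The oscillation bound 2M makes the difference nonpositive on t =
0, s = 0 and s = s₀. At a positive maximum elsewhere both points have the same gradient, with slope
d = Θ' ≥ 1 along `e`. The difference N of the Hessians is nonpositive, and N(e,e) ≤ 4Θ'' = -4bd².

Ellipticity (`exists_coeff_lower`) bounds the coefficient matrix below by (c/d²) e⊗e. The powers of
d cancel, so the trace of the coefficients against N is at most -4cb = -4M/t₀, which beats the 2M/t₀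
from the time term; this is the contradiction in `osc_le`. Dividing by s at t = t₀ gives the slope
bound Θ'(0) = exp(2M²/(ct₀)).

Since F is comparable with the norm, F(Du - φ⁰) ≤ D exp(2M²/(ct)). As (|u| - 2M)² ≥ M², for short
times the stated barrier with q = 2 absorbs both D and the factor t. -/

/-- The second derivative is nonpositive at a local maximum. -/
lemma second_deriv_nonpos_of_isLocalMax {g g' : ℝ → ℝ} {a g'' : ℝ} (h : IsLocalMax g a)
    (hg : ∀ᶠ s in 𝓝 a, HasDerivAt g (g' s) s) (hg' : HasDerivAt g' g'' a) : g'' ≤ 0 := by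
  by_contra! hpos
  have hd : deriv g =ᶠ[𝓝 a] g' := hg.mono fun s hs => hs.deriv
  have hdd : deriv (deriv g) a = g'' := by rw [hd.deriv_eq, hg'.deriv]
  have hmin : IsLocalMin g a :=
    isLocalMin_of_deriv_deriv_pos (by rw [hdd]; exact hpos) h.deriv_eq_zero
      hg.self_of_nhds.continuousAt
  -- A local maximum that is also a local minimum is locally constant, so its second derivative is
  -- zero.
  have hconst : g =ᶠ[𝓝 a] fun _ => g a := by
    filter_upwards [h, hmin] with s h1 h2 using le_antisymm h1 h2
  have h0 : deriv (deriv g) a = 0 := by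
    have h1 : deriv g =ᶠ[𝓝 a] fun _ => 0 := by simpa using hconst.deriv
    simpa using h1.deriv_eq
  linarith

/-! ### Derivatives along lines. -/

section Line

variable {E : Type*} [NormedAddCommGroup E] [NormedSpace ℝ E]

lemma hasDerivAt_line {f : E → ℝ} {x w : E} {s : ℝ} (hf : DifferentiableAt ℝ f (x + s • w)) :
    HasDerivAt (fun s : ℝ => f (x + s • w)) (fderiv ℝ f (x + s • w) w) s := by
  have h1 : HasDerivAt (fun s : ℝ => x + s • w) w s := by
    simpa using ((hasDerivAt_id s).smul_const w).const_add x
  exact hf.hasFDerivAt.comp_hasDerivAt s h1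

lemma eventually_hasDerivAt_line {f : E → ℝ} {x : E} (hf : ContDiffAt ℝ 2 f x) (w : E) :
    ∀ᶠ s : ℝ in 𝓝 0, HasDerivAt (fun s : ℝ => f (x + s • w)) (fderiv ℝ f (x + s • w) w) s := by
  have h1 : ∀ᶠ y in 𝓝 x, DifferentiableAt ℝ f y :=
    (hf.eventually (by simp)).mono fun y hy => hy.differentiableAt (by simp)
  have h2 : Tendsto (fun s : ℝ => x + s • w) (𝓝 0) (𝓝 x) := by
    have : Continuous fun s : ℝ => x + s • w := by fun_prop
    simpa using this.tendsto 0
  exact (h2.eventually h1).mono fun s hs => hasDerivAt_line hs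

lemma hasDerivAt_fderiv_line {f : E → ℝ} {x : E} (hf : ContDiffAt ℝ 2 f x) (w v : E) :
    HasDerivAt (fun s : ℝ => fderiv ℝ f (x + s • w) v) (fderiv ℝ (fderiv ℝ f) x w v) 0 := by
  have h0 : DifferentiableAt ℝ (fderiv ℝ f) x :=
    (hf.fderiv_right (m := 1) (by norm_num)).differentiableAt (by simp)
  have h1 : HasDerivAt (fun s : ℝ => x + s • w) w 0 := by
    simpa using ((hasDerivAt_id (0 : ℝ)).smul_const w).const_add x
  have h2 : HasFDerivAt (fderiv ℝ f) (fderiv ℝ (fderiv ℝ f) x) (x + (0 : ℝ) • w) := by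
    simpa using h0.hasFDerivAt
  have h3 := h2.comp_hasDerivAt (0 : ℝ) h1
  simpa using h3.clm_apply (hasDerivAt_const (0 : ℝ) v)

end Line

/-! ### Homogeneity and ellipticity of the integrand. -/

lemma hess_eq {k : ℕ} (F : Euc k → ℝ) (z p q : Euc k) :
    hess F z p q = fderiv ℝ (fderiv ℝ F) z p q := by
  simp [hess, iteratedFDeriv_two_apply]

section Integrand

variable {k : ℕ} {F : Euc k → ℝ}

lemma IsAreaIntegrand.contDiffAt (hF : IsAreaIntegrand F) {z : Euc k} (hz : z ≠ 0) :
    ContDiffAt ℝ 3 F z :=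
  hF.contDiff.contDiffAt (isOpen_compl_singleton.mem_nhds hz)

lemma IsAreaIntegrand.differentiableAt (hF : IsAreaIntegrand F) {z : Euc k} (hz : z ≠ 0) :
    DifferentiableAt ℝ F z := (hF.contDiffAt hz).differentiableAt (by simp)

lemma IsAreaIntegrand.hess_symm (hF : IsAreaIntegrand F) {z : Euc k} (hz : z ≠ 0) (p q : Euc k) :
    hess F z p q = hess F z q p := by
  rw [hess_eq, hess_eq]
  exact ((hF.contDiffAt hz).isSymmSndFDerivAt (by simp; norm_num)) p q

/-- Euler's relation. -/
lemma IsAreaIntegrand.fderiv_self (hF : IsAreaIntegrand F) {z : Euc k} (hz : z ≠ 0) :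
    fderiv ℝ F z z = F z := by
  have h1 : HasDerivAt (fun s : ℝ => F (z + s • z)) (fderiv ℝ F z z) 0 := by
    simpa using hasDerivAt_line (f := F) (x := z) (w := z) (s := 0)
      (by simpa using hF.differentiableAt hz)
  have h2 : HasDerivAt (fun s : ℝ => (1 + s) * F z) (F z) 0 := by
    simpa using ((hasDerivAt_id (0 : ℝ)).const_add 1).mul_const (F z)
  have h3 : (fun s : ℝ => F (z + s • z)) =ᶠ[𝓝 0] fun s => (1 + s) * F z := by
    filter_upwards [lt_mem_nhds (show (-1 : ℝ) < 0 by norm_num)] with s hs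
    rw [← hF.homog (1 + s) z (by linarith), add_smul, one_smul]
  exact h1.unique (h2.congr_of_eventuallyEq h3)

/-- Differentiate Euler's relation DF|_y(y) = F(y): the term DF|_z(w) appears on both sides and
cancels. -/
lemma IsAreaIntegrand.hess_self_right (hF : IsAreaIntegrand F) {z : Euc k} (hz : z ≠ 0)
    (w : Euc k) : hess F z w z = 0 := by
  have hC : ContDiffAt ℝ 2 F z := (hF.contDiffAt hz).of_le (by norm_num)
  have hd : DifferentiableAt ℝ (fderiv ℝ F) z :=
    (hC.fderiv_right (m := 1) (by norm_num)).differentiableAt (by simp)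
  have h1 : HasFDerivAt (fun y => fderiv ℝ F y y)
      ((fderiv ℝ F z).comp (ContinuousLinearMap.id ℝ _) + (fderiv ℝ (fderiv ℝ F) z).flip z) z :=
    hd.hasFDerivAt.clm_apply (hasFDerivAt_id z)
  have h2 : (fun y => fderiv ℝ F y y) =ᶠ[𝓝 z] F := by
    filter_upwards [isOpen_compl_singleton.mem_nhds hz] with y hy using hF.fderiv_self hy
  have h3 := (h1.congr_of_eventuallyEq h2.symm).unique (hF.differentiableAt hz).hasFDerivAt
  have h4 := congrArg (fun L => L w) h3
  simp at h4
  rw [hess_eq, h4]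

lemma IsAreaIntegrand.hess_self_left (hF : IsAreaIntegrand F) {z : Euc k} (hz : z ≠ 0)
    (w : Euc k) : hess F z z w = 0 := by
  rw [hF.hess_symm hz, hF.hess_self_right hz]

/-- `F` is comparable with the norm. -/
lemma IsAreaIntegrand.exists_bounds (hF : IsAreaIntegrand F) :
    ∃ m B : ℝ, 0 < m ∧ 0 < B ∧ ∀ z, z ≠ 0 → m * ‖z‖ ≤ F z ∧ F z ≤ B * ‖z‖ := by
  have hcont : ContinuousOn F (Metric.sphere 0 1) :=
    hF.contDiff.continuousOn.mono fun x hx => by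
      rintro rfl
      simp at hx
  have hK : IsCompact (Metric.sphere (0 : Euc k) 1) := isCompact_sphere 0 1
  have key : ∀ z : Euc k, z ≠ 0 → ‖z‖⁻¹ • z ∈ Metric.sphere (0 : Euc k) 1 ∧
      F z = ‖z‖ * F (‖z‖⁻¹ • z) := fun z hz => by
    have hz' : 0 < ‖z‖ := norm_pos_iff.2 hz
    refine ⟨by simp [norm_smul, hz'.ne'], ?_⟩
    rw [hF.homog _ _ (inv_pos.2 hz'), mul_inv_cancel_left₀ hz'.ne']
  -- The sphere is empty in dimension zero, where there is no nonzero z.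
  rcases (Metric.sphere (0 : Euc k) 1).eq_empty_or_nonempty with he | hne
  · refine ⟨1, 1, one_pos, one_pos, fun z hz => ?_⟩
    have := (key z hz).1
    rw [he] at this
    exact this.elim
  · obtain ⟨a, ha, hamin⟩ := hK.exists_isMinOn hne hcont
    obtain ⟨b, hb, hbmax⟩ := hK.exists_isMaxOn hne hcont
    have ne0 : ∀ y ∈ Metric.sphere (0 : Euc k) 1, y ≠ 0 := by
      rintro y hy rfl
      simp at hy
    refine ⟨F a, F b, hF.pos a (ne0 a ha), hF.pos b (ne0 b hb), fun z hz => ?_⟩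
    obtain ⟨hz1, hz2⟩ := key z hz
    rw [hz2, mul_comm (F a), mul_comm (F b)]
    exact ⟨mul_le_mul_of_nonneg_left (hamin hz1) (norm_nonneg z),
      mul_le_mul_of_nonneg_left (hbmax hz1) (norm_nonneg z)⟩

/-- Uniform convexity of the sublevel sets bounds the Hessian from below on tangent vectors. -/
lemma IsAreaIntegrand.exists_tangent_hess_lower (hF : IsAreaIntegrand F) :
    ∃ c : ℝ, 0 < c ∧ ∀ z, z ≠ 0 → ∀ w, IsTangent F z w → c * ‖w‖ ^ 2 ≤ F z * hess F z w w := by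
  obtain ⟨c, hc, hK⟩ := hF.uniformlyConvex 1 one_pos
  obtain ⟨m, B, hm, hB, hmB⟩ := hF.exists_bounds
  refine ⟨4 * c * m, by positivity, fun z hz w hw => ?_⟩
  have hFz : 0 < F z := hF.pos z hz
  have hz' : 0 < ‖z‖ := norm_pos_iff.2 hz
  rcases eq_or_ne w 0 with rfl | hw0
  · simp [hess_eq]
  have hw' : 0 < ‖w‖ := norm_pos_iff.2 hw0
  -- Chosen so that the ball radius ρ below satisfies ρ/‖z‖ = 2κs²/μ².
  set κ : ℝ := 2 * c * ‖w‖ ^ 2 / ‖z‖ with hκ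
  have hκ0 : 0 < κ := by positivity
  suffices h : 2 * κ ≤ hess F z w w by
    calc 4 * c * m * ‖w‖ ^ 2 = (m * ‖z‖) * (2 * κ) := by rw [hκ]; field_simp; ring
      _ ≤ F z * hess F z w w := mul_le_mul (hmB z hz).1 h (by positivity) hFz.le
  by_contra! hlt
  have hC : ContDiffAt ℝ 2 F z := (hF.contDiffAt hz).of_le (by norm_num)
  -- near `0`, `F (z + s w) ≤ F z + κ s²`
  have hupper : ∀ᶠ s : ℝ in 𝓝 0, F (z + s • w) ≤ F z + κ * s ^ 2 := by
    set g : ℝ → ℝ := fun s => κ * s ^ 2 - F (z + s • w) with hg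
    have hg1 : ∀ᶠ s : ℝ in 𝓝 0, HasDerivAt g (2 * κ * s - fderiv ℝ F (z + s • w) w) s := by
      filter_upwards [eventually_hasDerivAt_line hC w] with s hs
      have := (((hasDerivAt_id s).pow 2).const_mul κ).sub hs
      refine this.congr_deriv ?_
      simp
      ring
    have hg2 : HasDerivAt (fun s : ℝ => 2 * κ * s - fderiv ℝ F (z + s • w) w)
        (2 * κ - hess F z w w) 0 := by
      rw [hess_eq]
      refine (((hasDerivAt_id (0 : ℝ)).const_mul (2 * κ)).sub
        (hasDerivAt_fderiv_line hC w w)).congr_deriv ?_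
      simp
    have hd : deriv g =ᶠ[𝓝 0] _ := hg1.mono fun s hs => hs.deriv
    -- Tangency of w kills g'(0), and g''(0) = 2κ - D²F(w,w) > 0 by the contrary assumption.
    have hmin : IsLocalMin g 0 := by
      refine isLocalMin_of_deriv_deriv_pos ?_ ?_ hg1.self_of_nhds.continuousAt
      · rw [hd.deriv_eq, hg2.deriv]
        linarith
      · rw [hg1.self_of_nhds.deriv]
        have : fderiv ℝ F z w = 0 := hw
        simp [this]
    filter_upwards [hmin] with s hs
    simp [hg] at hs
    linarith
  have hneg : ∀ᶠ s : ℝ in 𝓝 0, F (z + (-s) • w) ≤ F z + κ * (-s) ^ 2 := by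
    have ht : Tendsto (fun s : ℝ => -s) (𝓝 0) (𝓝 0) := by
      simpa using (continuous_neg (G := ℝ)).tendsto 0
    exact ht.eventually hupper
  have hsmall : ∀ᶠ s : ℝ in 𝓝 0, κ * s ^ 2 < F z := by
    have : Continuous fun s : ℝ => κ * s ^ 2 := by fun_prop
    exact (this.tendsto 0).eventually_lt_const (by simpa using hFz)
  have hne : ∃ᶠ s : ℝ in 𝓝 0, s ≠ 0 := by
    have : ∃ᶠ s : ℝ in 𝓝[≠] 0, s ∈ ({0}ᶜ : Set ℝ) := eventually_mem_nhdsWithin.frequently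
    exact this.filter_mono nhdsWithin_le_nhds
  obtain ⟨s, hs0, h1, h2, h3⟩ := (hne.and_eventually (hupper.and (hneg.and hsmall))).exists
  -- Dividing z ± sw by μ puts both points in {F ≤ 1}, so one convexity constant serves every z.
  set μ : ℝ := F z + κ * s ^ 2 with hμ
  have hs2 : 0 < s ^ 2 := by positivity
  have hμ0 : 0 < μ := by positivity
  have mem : ∀ y, F y ≤ μ → F (μ⁻¹ • y) ≤ 1 := fun y hy => by
    rw [hF.homog _ _ (inv_pos.2 hμ0), inv_mul_le_iff₀ hμ0, mul_one]
    exact hy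
  rw [neg_sq] at h2
  have hball := hK _ (mem _ h1) _ (mem _ h2)
  set ρ : ℝ := c * ‖μ⁻¹ • (z + s • w) - μ⁻¹ • (z + (-s) • w)‖ ^ 2 with hρ
  have hρ' : ρ = 4 * c * s ^ 2 * ‖w‖ ^ 2 / μ ^ 2 := by
    have : μ⁻¹ • (z + s • w) - μ⁻¹ • (z + (-s) • w) = (μ⁻¹ * (2 * s)) • w := by module
    rw [hρ, this, norm_smul, mul_pow, Real.norm_eq_abs, sq_abs]
    field_simp
    ring
  have hmid : midpoint ℝ (μ⁻¹ • (z + s • w)) (μ⁻¹ • (z + (-s) • w)) = μ⁻¹ • z := by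
    rw [midpoint_eq_smul_add, invOf_eq_inv]
    module
  have hρ0 : 0 ≤ ρ := by positivity
  -- Push the midpoint z/μ radially to the boundary of the ball; F is linear along the ray, so its
  -- value there is explicit.
  have hin : μ⁻¹ • z + (ρ / ‖z‖) • z ∈ {v | F v ≤ 1} := by
    apply hball
    rw [hmid, Metric.mem_closedBall, dist_eq_norm, add_sub_cancel_left, norm_smul, norm_div,
      norm_norm, div_mul_cancel₀ _ hz'.ne', Real.norm_of_nonneg hρ0]
  have hval : (μ⁻¹ + ρ / ‖z‖) * F z ≤ 1 := by
    rw [← hF.homog _ _ (by positivity), add_smul]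
    exact hin
  have hρz : ρ / ‖z‖ = 2 * κ * s ^ 2 / μ ^ 2 := by
    rw [hρ', hκ]
    field_simp
    ring
  rw [hρz] at hval
  have h4 : (μ + 2 * κ * s ^ 2) * F z ≤ μ ^ 2 := by
    have : (μ⁻¹ + 2 * κ * s ^ 2 / μ ^ 2) * F z = (μ + 2 * κ * s ^ 2) * F z / μ ^ 2 := by
      field_simp
    rw [this, div_le_one (by positivity)] at hval
    exact hval
  have h5 : 0 < κ * s ^ 2 := by positivity
  rw [hμ] at h4
  -- Expanding `h4` leaves F(z)·κs² ≤ (κs²)², against κs² < F(z).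
  nlinarith

/-- Lower bound of the Hessian through a linear functional that annihilates the base point. -/
lemma IsAreaIntegrand.exists_hess_lower (hF : IsAreaIntegrand F) :
    ∃ c : ℝ, 0 < c ∧ ∀ z, z ≠ 0 → ∀ (l : Euc k →ₗ[ℝ] ℝ) (Λ : ℝ), l z = 0 →
      (∀ w, |l w| ≤ Λ * ‖w‖) → ∀ w, c * l w ^ 2 ≤ Λ ^ 2 * (F z * hess F z w w) := by
  obtain ⟨c, hc, h⟩ := hF.exists_tangent_hess_lower
  refine ⟨c, hc, fun z hz l Λ hlz hl w => ?_⟩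
  have hFz : 0 < F z := hF.pos z hz
  -- Subtracting this multiple of z makes w tangent; neither the Hessian nor l sees multiples of z.
  set a : ℝ := fderiv ℝ F z w / F z with ha
  have hT : IsTangent F z (w - a • z) := by
    simp [IsTangent, hF.fderiv_self hz, ha, hFz.ne']
  have hh : hess F z (w - a • z) (w - a • z) = hess F z w w := by
    have h1 := hF.hess_self_left hz w
    have h2 := hF.hess_self_right hz w
    have h3 := hF.hess_self_right hz z
    rw [hess_eq] at h1 h2 h3 ⊢
    rw [hess_eq]
    simp [h1, h2, h3]
  have h1 := h z hz _ hT
  rw [hh] at h1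
  have h2 : l w = l (w - a • z) := by simp [hlz]
  have h3 : l w ^ 2 ≤ Λ ^ 2 * ‖w - a • z‖ ^ 2 := by
    rw [h2, ← sq_abs, ← mul_pow]
    exact pow_le_pow_left₀ (abs_nonneg _) (hl _) 2
  calc c * l w ^ 2 ≤ c * (Λ ^ 2 * ‖w - a • z‖ ^ 2) := by gcongr
    _ = Λ ^ 2 * (c * ‖w - a • z‖ ^ 2) := by ring
    _ ≤ _ := by gcongr

end Integrand

/-- Ellipticity of the coefficients of the flow in the direction `e`: as the slope `p · e` grows it
degenerates at most like `(p · e)⁻²`. -/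
lemma IsAreaIntegrand.exists_coeff_lower {n : ℕ} {F : Euc (n + 1) → ℝ} (hF : IsAreaIntegrand F)
    (φ : Module.Basis (Fin (n + 1)) ℝ (Euc (n + 1))) :
    ∃ c : ℝ, 0 < c ∧ ∀ (p : Fin n → ℝ) (e : Euc n), ‖e‖ = 1 → 1 ≤ ∑ i, p i * e i →
      ∀ v : Fin n → ℝ, c * (∑ i, e i * v i) ^ 2 ≤ (∑ i, p i * e i) ^ 2 *
        (F ((∑ i, p i • φ i.succ) - φ 0) * hess F ((∑ i, p i • φ i.succ) - φ 0)
          (∑ i, v i • φ i.succ) (∑ i, v i • φ i.succ)) := by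
  obtain ⟨c, hc, h⟩ := hF.exists_hess_lower
  set L : Fin (n + 1) → (Euc (n + 1) →L[ℝ] ℝ) := fun j => (φ.coord j).toContinuousLinearMap with hL
  set K : ℝ := ∑ j, ‖L j‖ + 1 with hK
  have hK0 : 0 < K := by positivity
  refine ⟨c / K ^ 2, by positivity, fun p e he hpe v => ?_⟩
  set d : ℝ := ∑ i, p i * e i with hd
  set z := (∑ i, p i • φ i.succ) - φ 0 with hzdef
  -- The φ⁰-coordinate of z is always -1.
  have hz : z ≠ 0 := fun h0 => by
    have : φ.repr z 0 = -1 := by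
      simp [hzdef, Fin.succ_ne_zero]
    rw [h0] at this
    simp at this
  -- The value d on φ⁰ forces l(z) = p·e - d = 0. As |e_i| ≤ 1 ≤ d, the norm of l grows only
  -- linearly in d, whence the rate d⁻².
  set l : Euc (n + 1) →ₗ[ℝ] ℝ := φ.constr ℝ (Fin.cons d fun i => e i : Fin (n + 1) → ℝ) with hl
  have hl0 : l (φ 0) = d := by simp [hl]
  have hls : ∀ i : Fin n, l (φ i.succ) = e i := fun i => by simp [hl]
  have hlz : l z = 0 := by simp [hzdef, hl0, hls, hd]
  have hcoef : ∀ j, |(Fin.cons d fun i => e i : Fin (n + 1) → ℝ) j| ≤ d := by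
    intro j
    refine Fin.cases ?_ (fun i => ?_) j
    · simp [abs_of_nonneg (zero_le_one.trans hpe)]
    · have := PiLp.norm_apply_le e i
      rw [he] at this
      simpa using this.trans hpe
  have hbound : ∀ w, |l w| ≤ d * K * ‖w‖ := by
    intro w
    rw [hl, Module.Basis.constr_apply_fintype]
    calc |∑ j, φ.equivFun w j • (Fin.cons d fun i => e i : Fin (n + 1) → ℝ) j|
        ≤ ∑ j, |φ.equivFun w j • (Fin.cons d fun i => e i : Fin (n + 1) → ℝ) j| :=
          Finset.abs_sum_le_sum_abs _ _
      _ ≤ ∑ j, (‖L j‖ * ‖w‖) * d := by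
          refine Finset.sum_le_sum fun j _ => ?_
          rw [smul_eq_mul, abs_mul]
          exact mul_le_mul ((L j).le_opNorm w) (hcoef j) (abs_nonneg _) (by positivity)
      _ = d * (∑ j, ‖L j‖) * ‖w‖ := by rw [← Finset.sum_mul, ← Finset.sum_mul]; ring
      _ ≤ d * K * ‖w‖ := by
          have : 0 ≤ d := zero_le_one.trans hpe
          gcongr
          linarith
  have h1 := h z hz l (d * K) hlz hbound (∑ i, v i • φ i.succ)
  have h2 : l (∑ i, v i • φ i.succ) = ∑ i, e i * v i := by
    simp [hls, mul_comm]
  rw [h2] at h1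
  rw [div_mul_eq_mul_div, div_le_iff₀ (by positivity)]
  linarith

/-! ### Traces of semidefinite matrices. -/

/-- The trace of the product of a positive and a negative semidefinite matrix is nonpositive. -/
lemma sum_mul_nonpos_of_posSemidef {n : ℕ} {B N : Matrix (Fin n) (Fin n) ℝ} (hB : B.PosSemidef)
    (hN : ∀ f : Fin n → ℝ, ∑ i, ∑ j, f i * f j * N i j ≤ 0) :
    ∑ i, ∑ j, B i j * N i j ≤ 0 := by
  obtain ⟨m, v, rfl⟩ := Matrix.posSemidef_iff_eq_sum_vecMulVec.1 hB
  have : ∑ i, ∑ j, (∑ k, Matrix.vecMulVec (v k) (star (v k))) i j * N i j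
      = ∑ k, ∑ i, ∑ j, v k i * v k j * N i j := by
    rw [Finset.sum_comm (s := Finset.univ (α := Fin m))]
    refine Finset.sum_congr rfl fun i _ => ?_
    rw [Finset.sum_comm (s := Finset.univ (α := Fin m))]
    refine Finset.sum_congr rfl fun j _ => ?_
    rw [Matrix.sum_apply, Finset.sum_mul]
    simp [Matrix.vecMulVec_apply]
  rw [this]
  exact Finset.sum_nonpos fun k _ => hN _

/-- The matrix a - c e⊗e is positive semidefinite, so its trace against N is nonpositive. This
retains only the direction in which the barrier is strictly concave. -/
lemma sum_mul_le_of_rank_one_le {n : ℕ} {a N : Matrix (Fin n) (Fin n) ℝ} {e : Fin n → ℝ} {c : ℝ}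
    (hsymm : ∀ i j, a i j = a j i)
    (ha : ∀ v : Fin n → ℝ, c * (∑ i, e i * v i) ^ 2 ≤ ∑ i, ∑ j, v i * v j * a i j)
    (hN : ∀ f : Fin n → ℝ, ∑ i, ∑ j, f i * f j * N i j ≤ 0) :
    ∑ i, ∑ j, a i j * N i j ≤ c * ∑ i, ∑ j, e i * e j * N i j := by
  have hB : (a - c • Matrix.vecMulVec e e).PosSemidef := by
    refine .of_dotProduct_mulVec_nonneg ?_ fun v => ?_
    · ext i j
      simp [Matrix.vecMulVec_apply, hsymm j i, mul_comm]
    · have h1 : star v ⬝ᵥ (a - c • Matrix.vecMulVec e e).mulVec v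
          = ∑ i, ∑ j, v i * v j * a i j - c * (∑ i, e i * v i) ^ 2 := by
        rw [sq, Finset.sum_mul_sum, Finset.mul_sum, ← Finset.sum_sub_distrib]
        refine Finset.sum_congr rfl fun i _ => ?_
        rw [Finset.mul_sum, ← Finset.sum_sub_distrib, Matrix.mulVec, dotProduct, Finset.mul_sum]
        refine Finset.sum_congr rfl fun j _ => ?_
        simp [Matrix.vecMulVec_apply]
        ring
      rw [h1]
      linarith [ha v]
  have := sum_mul_nonpos_of_posSemidef hB hN
  have h2 : ∑ i, ∑ j, (a - c • Matrix.vecMulVec e e) i j * N i j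
      = ∑ i, ∑ j, a i j * N i j - c * ∑ i, ∑ j, e i * e j * N i j := by
    rw [Finset.mul_sum, ← Finset.sum_sub_distrib]
    refine Finset.sum_congr rfl fun i _ => ?_
    rw [Finset.mul_sum, ← Finset.sum_sub_distrib]
    refine Finset.sum_congr rfl fun j _ => ?_
    simp [Matrix.vecMulVec_apply]
    ring
  linarith

/-! ### Derivative tests at a maximum. -/

lemma nonpos_of_hasDerivWithinAt_right {g : ℝ → ℝ} {a b d : ℝ} (hab : a < b)
    (hg : HasDerivWithinAt g d (Set.Icc a b) a) (hmax : ∀ s ∈ Set.Icc a b, g s ≤ g a) : d ≤ 0 := by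
  have h1 : HasDerivWithinAt g d (Set.Ioc a b) a := hg.mono Set.Ioc_subset_Icc_self
  rw [hasDerivWithinAt_iff_tendsto_slope' (by simp)] at h1
  have : (𝓝[Set.Ioc a b] a).NeBot := by
    rw [nhdsWithin_Ioc_eq_nhdsGT hab]
    infer_instance
  refine le_of_tendsto h1 (eventually_mem_nhdsWithin.mono fun s hs => ?_)
  rw [slope_def_field]
  exact div_nonpos_of_nonpos_of_nonneg (sub_nonpos.2 (hmax s ⟨hs.1.le, hs.2⟩))
    (sub_nonneg.2 hs.1.le)

lemma nonneg_of_hasDerivWithinAt_left {g : ℝ → ℝ} {a b d : ℝ} (hab : a < b)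
    (hg : HasDerivWithinAt g d (Set.Icc a b) b) (hmax : ∀ s ∈ Set.Icc a b, g s ≤ g b) : 0 ≤ d := by
  have h1 : HasDerivWithinAt g d (Set.Ico a b) b := hg.mono Set.Ico_subset_Icc_self
  rw [hasDerivWithinAt_iff_tendsto_slope' (by simp)] at h1
  have : (𝓝[Set.Ico a b] b).NeBot := by
    rw [nhdsWithin_Ico_eq_nhdsLT hab]
    infer_instance
  refine ge_of_tendsto h1 (eventually_mem_nhdsWithin.mono fun s hs => ?_)
  rw [slope_def_field]
  exact div_nonneg_of_nonpos (sub_nonpos.2 (hmax s ⟨hs.1, hs.2.le⟩)) (sub_nonpos.2 hs.2.le)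

/-- First and second order conditions at a maximum of `f (x + s e) - f x - Θ s` in `(x, s)`. -/
lemma doubling_max_conditions {E : Type*} [NormedAddCommGroup E] [NormedSpace ℝ E] {f : E → ℝ}
    (hf : ContDiff ℝ 2 f) {x e : E} {s : ℝ} {Θ Θ' : ℝ → ℝ} {Θ'' : ℝ}
    (hΘ : ∀ᶠ σ in 𝓝 s, HasDerivAt Θ (Θ' σ) σ) (hΘ' : HasDerivAt Θ' Θ'' s)
    (hmax : ∀ᶠ σ in 𝓝 s, ∀ x', f (x' + σ • e) - f x' - Θ σ ≤ f (x + s • e) - f x - Θ s) :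
    fderiv ℝ f (x + s • e) = fderiv ℝ f x ∧ fderiv ℝ f x e = Θ' s ∧
      (∀ w, fderiv ℝ (fderiv ℝ f) (x + s • e) w w - fderiv ℝ (fderiv ℝ f) x w w ≤ 0) ∧
      fderiv ℝ (fderiv ℝ f) (x + s • e) e e - fderiv ℝ (fderiv ℝ f) x e e ≤ 4 * Θ'' := by
  have hd : Differentiable ℝ f := hf.differentiable (by simp)
  -- Translating both points together leaves s, hence Θ, unchanged.
  have hline : ∀ w, IsLocalMax (fun τ : ℝ => f ((x + s • e) + τ • w) - f (x + τ • w)) 0 := by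
    intro w
    refine Eventually.of_forall fun τ => ?_
    have := hmax.self_of_nhds (x + τ • w)
    rw [add_right_comm] at this
    simp only [zero_smul, add_zero]
    linarith
  have hfirst : fderiv ℝ f (x + s • e) = fderiv ℝ f x := by
    ext w
    have h1 : HasDerivAt (fun τ : ℝ => f ((x + s • e) + τ • w) - f (x + τ • w))
        (fderiv ℝ f ((x + s • e) + (0 : ℝ) • w) w - fderiv ℝ f (x + (0 : ℝ) • w) w) 0 :=
      (hasDerivAt_line hd.differentiableAt).sub (hasDerivAt_line hd.differentiableAt)
    have := (hline w).hasDerivAt_eq_zero h1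
    simp only [zero_smul, add_zero] at this
    linarith
  refine ⟨hfirst, ?_, fun w => ?_, ?_⟩
  · have h1 : HasDerivAt (fun σ : ℝ => f (x + σ • e) - f x - Θ σ)
        (fderiv ℝ f (x + s • e) e - Θ' s) s :=
      ((hasDerivAt_line hd.differentiableAt).sub_const _).sub hΘ.self_of_nhds
    have h2 : IsLocalMax (fun σ : ℝ => f (x + σ • e) - f x - Θ σ) s :=
      hmax.mono fun σ hσ => hσ x
    have := h2.hasDerivAt_eq_zero h1
    rw [← hfirst]
    linarith
  · exact second_deriv_nonpos_of_isLocalMax (hline w)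
      (Eventually.of_forall fun τ =>
        (hasDerivAt_line hd.differentiableAt).sub (hasDerivAt_line hd.differentiableAt))
      ((hasDerivAt_fderiv_line hf.contDiffAt w w).sub (hasDerivAt_fderiv_line hf.contDiffAt w w))
  · have ht : Tendsto (fun τ : ℝ => s + 2 * τ) (𝓝 0) (𝓝 s) := by
      have : Continuous fun τ : ℝ => s + 2 * τ := by fun_prop
      simpa using this.tendsto 0
    have haff : ∀ τ : ℝ, HasDerivAt (fun τ : ℝ => s + 2 * τ) 2 τ := fun τ => by
      simpa using ((hasDerivAt_id τ).const_mul 2).const_add s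
    -- Moving the two points apart by ±τe changes s by 2τ, hence the factor 4 on Θ''.
    have hloc : IsLocalMax
        (fun τ : ℝ => f ((x + s • e) + τ • e) - f (x + τ • (-e)) - Θ (s + 2 * τ)) 0 := by
      filter_upwards [ht.eventually hmax] with τ hτ
      have h1 := hτ (x + τ • (-e))
      have h2 : x + τ • (-e) + (s + 2 * τ) • e = (x + s • e) + τ • e := by module
      rw [h2] at h1
      simpa using h1
    have h1 : ∀ᶠ τ : ℝ in 𝓝 0, HasDerivAt
        (fun τ : ℝ => f ((x + s • e) + τ • e) - f (x + τ • (-e)) - Θ (s + 2 * τ))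
        (fderiv ℝ f ((x + s • e) + τ • e) e - fderiv ℝ f (x + τ • (-e)) (-e)
          - Θ' (s + 2 * τ) * 2) τ := by
      filter_upwards [ht.eventually hΘ] with τ hτ
      exact ((hasDerivAt_line hd.differentiableAt).sub (hasDerivAt_line hd.differentiableAt)).sub
        (hτ.comp τ (haff τ))
    have hΘ0 : HasDerivAt Θ' Θ'' (s + 2 * 0) := by simpa using hΘ'
    have h2 : HasDerivAt (fun τ : ℝ => fderiv ℝ f ((x + s • e) + τ • e) e
        - fderiv ℝ f (x + τ • (-e)) (-e) - Θ' (s + 2 * τ) * 2)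
        (fderiv ℝ (fderiv ℝ f) (x + s • e) e e - fderiv ℝ (fderiv ℝ f) x (-e) (-e)
          - Θ'' * 2 * 2) 0 :=
      ((hasDerivAt_fderiv_line hf.contDiffAt e e).sub
        (hasDerivAt_fderiv_line hf.contDiffAt (-e) (-e))).sub
        ((hΘ0.comp (0 : ℝ) (haff 0)).mul_const 2)
    have h3 := second_deriv_nonpos_of_isLocalMax hloc h1 h2
    simp only [map_neg, neg_apply, neg_neg] at h3
    linarith

/-! ### Periodicity and coordinates for the solution. -/

/-- Every point can be moved by a period into a fixed ball. -/
lemma IsSpatiallyPeriodic.exists_radius {n : ℕ} {T : ℝ} {u : Euc n → ℝ → ℝ}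
    (h : IsSpatiallyPeriodic T u) : ∃ R : ℝ, ∀ x, ∃ x' ∈ Metric.closedBall (0 : Euc n) R,
      ∀ w, ∀ t ∈ Set.Icc 0 T, u (x' + w) t = u (x + w) t := by
  obtain ⟨L, hL1, hL2, hL⟩ := h
  have := ZLattice.module_free ℝ L
  have := ZLattice.module_finite ℝ L
  set b := (Module.Free.chooseBasis ℤ L).ofZLatticeBasis ℝ L with hb
  -- The fundamental parallelepiped of a lattice basis lies in this ball.
  refine ⟨∑ i, ‖b i‖, fun x => ⟨ZSpan.fract b x, ?_, fun w t ht => ?_⟩⟩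
  · simpa using ZSpan.norm_fract_le b x
  · have hmem : (ZSpan.floor b x : Euc n) ∈ L :=
      (Module.Basis.ofZLatticeBasis_span ℝ L _).le (ZSpan.floor b x).2
    have := hL _ hmem (ZSpan.fract b x + w) t ht
    rw [← this, ZSpan.fract_apply]
    congr 1
    abel

variable {n : ℕ} {φ : Module.Basis (Fin (n + 1)) ℝ (Euc (n + 1))} {F : Euc (n + 1) → ℝ} {T : ℝ}
  {u : Euc n → ℝ → ℝ}

lemma IsSolution.contDiff_slice (hu : IsSolution φ F T u) {t : ℝ} (ht : t ∈ Set.Icc 0 T) :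
    ContDiff ℝ 2 (fun y => u y t) := by
  have h1 : ContDiffOn ℝ 3 (fun y : Euc n => u y t) Set.univ :=
    hu.contDiff.comp (f := fun y : Euc n => (y, t)) (by fun_prop) fun y _ => ⟨trivial, ht⟩
  exact (contDiffOn_univ.1 h1).of_le (by norm_num)

lemma sum_smul_unitVec (e : Euc n) : ∑ i, e i • unitVec i = e := by
  ext j
  simp [unitVec, Finset.sum_apply, Pi.single_apply]

lemma fderiv_eq_sum_partialX (u : Euc n → ℝ → ℝ) (x e : Euc n) (t : ℝ) :
    fderiv ℝ (fun y => u y t) x e = ∑ i, partialX u x t i * e i := by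
  conv_lhs => rw [← sum_smul_unitVec e]
  simp [partialX, mul_comm]

lemma fderiv_fderiv_eq_sum_partialXX (u : Euc n → ℝ → ℝ) (x : Euc n) (t : ℝ) (f : Fin n → ℝ) :
    fderiv ℝ (fderiv ℝ (fun y => u y t)) x (∑ i, f i • unitVec i) (∑ i, f i • unitVec i)
      = ∑ i, ∑ j, f i * f j * partialXX u x t i j := by
  simp only [map_sum, map_smul, sum_apply, smul_apply, partialXX, iteratedFDeriv_two_apply,
    Finset.mul_sum, smul_eq_mul, Matrix.cons_val_zero, Matrix.cons_val_one]
  rw [Finset.sum_comm]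
  refine Finset.sum_congr rfl fun i _ => Finset.sum_congr rfl fun j _ => by ring

/-! ### The barrier argument and the gradient bound. -/

/-- Comparison with a translating barrier: the oscillation of `u` along segments in the
direction `e` is controlled by a logarithm that steepens as the slope bound `exp (2 M b)`. -/
lemma IsSolution.osc_le (hF : IsAreaIntegrand F) (hu : IsSolution φ F T u)
    (hper : IsSpatiallyPeriodic T u) {M c b : ℝ} (hM : 0 < M) (hc : 0 < c) {e : Euc n}
    (hcoef : ∀ p : Fin n → ℝ, 1 ≤ ∑ i, p i * e i →
      ∀ v : Fin n → ℝ, c * (∑ i, e i * v i) ^ 2 ≤ (∑ i, p i * e i) ^ 2 *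
        (F ((∑ i, p i • φ i.succ) - φ 0) * hess F ((∑ i, p i • φ i.succ) - φ 0)
          (∑ i, v i • φ i.succ) (∑ i, v i • φ i.succ)))
    (hbd : ∀ x : Euc n, ∀ t ∈ Set.Icc 0 T, |u x t| ≤ M) {t₀ : ℝ} (ht₀ : 0 < t₀) (htT : t₀ ≤ T)
    (hb : b = M / (c * t₀)) {s₀ : ℝ} (hs₀ : 1 + b * Real.exp (2 * M * b) * s₀ = Real.exp (2 * M * b))
    (x : Euc n) (s : ℝ) (hs : s ∈ Set.Icc 0 s₀) (t : ℝ) (ht : t ∈ Set.Icc 0 t₀) :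
    u (x + s • e) t - u x t
      - Real.log (1 + b * Real.exp (2 * M * b) * s) / b - 2 * M * (1 - t / t₀) ≤ 0 := by
  have hb0 : 0 < b := by rw [hb]; positivity
  set G : ℝ := b * Real.exp (2 * M * b) with hG
  have hG0 : 0 < G := by positivity
  have hIcc : Set.Icc 0 t₀ ⊆ Set.Icc 0 T := Set.Icc_subset_Icc_right htT
  -- Θ rises from 0 to 2M on [0, s₀], while its slope falls from exp(2Mb) to 1, so the ellipticity
  -- hypothesis applies throughout.
  set Θ : ℝ → ℝ := fun s => Real.log (1 + G * s) / b with hΘdef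
  have hΘ0 : ∀ s, 0 ≤ s → 0 ≤ Θ s := fun s hs =>
    div_nonneg (Real.log_nonneg (by nlinarith)) hb0.le
  have hΘs₀ : Θ s₀ = 2 * M := by
    simp only [hΘdef, hs₀, Real.log_exp]
    field_simp
  set Θ' : ℝ → ℝ := fun s => G / (1 + G * s) / b with hΘ'def
  have haff : ∀ σ, HasDerivAt (fun σ : ℝ => 1 + G * σ) G σ := fun σ => by
    simpa using ((hasDerivAt_id σ).const_mul G).const_add 1
  have hd1 : ∀ σ, 0 < σ → HasDerivAt Θ (Θ' σ) σ := fun σ hσ =>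
    ((haff σ).log (by positivity)).div_const b
  have hd2 : ∀ σ, 0 < σ → HasDerivAt Θ' (-b * Θ' σ ^ 2) σ := fun σ hσ => by
    have hne : 1 + G * σ ≠ 0 := by positivity
    refine (((hasDerivAt_const σ G).div (haff σ) hne).div_const b).congr_deriv ?_
    simp only [hΘ'def]
    field_simp
    ring
  have hΘ'1 : ∀ σ, 0 < σ → σ < s₀ → 1 ≤ Θ' σ := fun σ hσ hσ' => by
    simp only [hΘ'def]
    rw [div_div, one_le_div (by positivity)]
    have : 1 + G * σ ≤ Real.exp (2 * M * b) := by
      rw [← hs₀]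
      gcongr
    calc (1 + G * σ) * b ≤ Real.exp (2 * M * b) * b := by gcongr
      _ = G := by rw [hG, mul_comm]
  set Z : Euc n × ℝ × ℝ → ℝ := fun q =>
    u (q.1 + q.2.1 • e) q.2.2 - u q.1 q.2.2 - Θ q.2.1 - 2 * M * (1 - q.2.2 / t₀) with hZ
  by_contra! hpos
  change 0 < Z (x, s, t) at hpos
  obtain ⟨R, hR⟩ := hper.exists_radius
  set K : Set (Euc n × ℝ × ℝ) := Metric.closedBall 0 R ×ˢ Set.Icc 0 s₀ ×ˢ Set.Icc 0 t₀ with hK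
  have hKc : IsCompact K := (isCompact_closedBall 0 R).prod (isCompact_Icc.prod isCompact_Icc)
  -- Periodicity turns a maximum over the compact set K into one over all of space.
  have hred : ∀ (y : Euc n) (σ τ : ℝ), σ ∈ Set.Icc 0 s₀ → τ ∈ Set.Icc 0 t₀ →
      ∃ q ∈ K, Z q = Z (y, σ, τ) := fun y σ τ hσ hτ => by
    obtain ⟨y', hy', h⟩ := hR y
    refine ⟨(y', σ, τ), ⟨hy', hσ, hτ⟩, ?_⟩
    have h1 := h (σ • e) τ (hIcc hτ)
    have h2 := h 0 τ (hIcc hτ)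
    simp only [add_zero] at h2
    simp only [hZ, h1, h2]
  have hcont : ContinuousOn Z K := by
    have hu0 := hu.contDiff.continuousOn
    have h1 : ContinuousOn (fun q : Euc n × ℝ × ℝ => u (q.1 + q.2.1 • e) q.2.2) K :=
      hu0.comp (f := fun q : Euc n × ℝ × ℝ => (q.1 + q.2.1 • e, q.2.2))
        (by fun_prop) fun q hq => ⟨trivial, hIcc hq.2.2⟩
    have h2 : ContinuousOn (fun q : Euc n × ℝ × ℝ => u q.1 q.2.2) K :=
      hu0.comp (f := fun q : Euc n × ℝ × ℝ => (q.1, q.2.2))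
        (by fun_prop) fun q hq => ⟨trivial, hIcc hq.2.2⟩
    have h3 : ContinuousOn (fun q : Euc n × ℝ × ℝ => Θ q.2.1) K := by
      refine ContinuousOn.div_const (ContinuousOn.log (by fun_prop) fun q hq => ?_) b
      have := hq.2.1.1
      positivity
    exact ((h1.sub h2).sub h3).sub (by fun_prop)
  obtain ⟨q₁, hq₁, hq₁Z⟩ := hred x s t hs ht
  obtain ⟨⟨y, σ, τ⟩, ⟨hyK, hσ, hτ⟩, hmaxK⟩ := hKc.exists_isMaxOn ⟨q₁, hq₁⟩ hcont
  have hmax : ∀ (y' : Euc n) (σ' τ' : ℝ), σ' ∈ Set.Icc 0 s₀ → τ' ∈ Set.Icc 0 t₀ →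
      Z (y', σ', τ') ≤ Z (y, σ, τ) := fun y' σ' τ' hσ' hτ' => by
    obtain ⟨q, hq, hqZ⟩ := hred y' σ' τ' hσ' hτ'
    rw [← hqZ]
    exact hmaxK hq
  have hZpos : 0 < Z (y, σ, τ) := hpos.trans_le (hmax x s t hs ht)
  replace hσ : σ ∈ Set.Icc 0 s₀ := hσ
  replace hτ : τ ∈ Set.Icc 0 t₀ := hτ
  have hosc : u (y + σ • e) τ - u y τ ≤ 2 * M := by
    have h1 := abs_le.1 (hbd (y + σ • e) τ (hIcc hτ))
    have h2 := abs_le.1 (hbd y τ (hIcc hτ))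
    linarith [h1.2, h2.1]
  have hlin : 0 ≤ 2 * M * (1 - τ / t₀) := by
    have : τ / t₀ ≤ 1 := (div_le_one ht₀).2 hτ.2
    nlinarith
  -- On the faces τ = 0, σ = 0 and σ = s₀, Z is nonpositive: respectively the time term, the
  -- vanishing increment of u, and Θ(s₀) = 2M absorb the oscillation.
  have hτ0 : 0 < τ := by
    refine hτ.1.lt_of_ne fun h => ?_
    have := hΘ0 σ hσ.1
    simp only [hZ, ← h, zero_div, sub_zero, mul_one] at hZpos
    rw [← h] at hosc
    linarith
  have hσ0 : 0 < σ := by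
    refine hσ.1.lt_of_ne fun h => ?_
    simp only [hZ, ← h, zero_smul, add_zero, sub_self] at hZpos
    linarith [hΘ0 0 le_rfl]
  have hσs₀ : σ < s₀ := by
    refine hσ.2.lt_of_ne fun h => ?_
    simp only [hZ] at hZpos
    rw [h, hΘs₀] at hZpos
    rw [h] at hosc
    linarith
  have hτT : τ ∈ Set.Icc 0 T := hIcc hτ
  obtain ⟨hgrad, hslope, hN, hNe⟩ := doubling_max_conditions (hu.contDiff_slice hτT)
    (x := y) (e := e) (s := σ) (Θ := Θ) (Θ' := Θ')
    ((lt_mem_nhds hσ0).mono fun σ' => hd1 σ') (hd2 σ hσ0) (by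
      filter_upwards [Icc_mem_nhds hσ0 hσs₀] with σ' hσ' x'
      have := hmax x' σ' τ hσ' hτ
      simp only [hZ] at this
      linarith)
  set p : Fin n → ℝ := fun i => partialX u y τ i with hp
  set z := (∑ i, p i • φ i.succ) - φ 0 with hz
  have hz1 : conormal φ u y τ = z := rfl
  have hz2 : conormal φ u (y + σ • e) τ = z := by
    simp only [conormal, partialX, hgrad, hz, hp]
  have hz0 : z ≠ 0 := fun h0 => by
    have : φ.repr z 0 = -1 := by simp [hz, Fin.succ_ne_zero]
    rw [h0] at this
    simp at this
  set d : ℝ := ∑ i, p i * e i with hd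
  have hdΘ : d = Θ' σ := by rw [← hslope, fderiv_eq_sum_partialX]
  have hd1' : 1 ≤ d := hdΘ ▸ hΘ'1 σ hσ0 hσs₀
  set a : Matrix (Fin n) (Fin n) ℝ := fun i j => F z * hess F z (φ i.succ) (φ j.succ) with ha
  set N : Matrix (Fin n) (Fin n) ℝ := fun i j =>
    partialXX u (y + σ • e) τ i j - partialXX u y τ i j with hNdef
  have hNf : ∀ f : Fin n → ℝ, ∑ i, ∑ j, f i * f j * N i j =
      fderiv ℝ (fderiv ℝ (fun y => u y τ)) (y + σ • e) (∑ i, f i • unitVec i) (∑ i, f i • unitVec i)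
      - fderiv ℝ (fderiv ℝ (fun y => u y τ)) y (∑ i, f i • unitVec i) (∑ i, f i • unitVec i) :=
    fun f => by
      simp only [fderiv_fderiv_eq_sum_partialXX, hNdef, mul_sub, Finset.sum_sub_distrib]
  have htrace : ∑ i, ∑ j, a i j * N i j ≤ c / d ^ 2 * ∑ i, ∑ j, e i * e j * N i j := by
    refine sum_mul_le_of_rank_one_le (fun i j => by simp only [ha, hF.hess_symm hz0])
      (fun v => ?_) fun f => by rw [hNf]; exact hN _
    have h1 := hcoef p hd1' v
    have h2 : F z * hess F z (∑ i, v i • φ i.succ) (∑ i, v i • φ i.succ)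
        = ∑ i, ∑ j, v i * v j * a i j := by
      simp only [ha, hess_eq, map_sum, map_smul, sum_apply, smul_apply, Finset.mul_sum,
        smul_eq_mul]
      rw [Finset.sum_comm]
      refine Finset.sum_congr rfl fun i _ => Finset.sum_congr rfl fun j _ => by ring
    rw [h2] at h1
    rw [div_mul_eq_mul_div, div_le_iff₀ (by positivity)]
    linarith
  have hNee : ∑ i, ∑ j, e i * e j * N i j ≤ 4 * (-b * d ^ 2) := by
    rw [hNf fun i => e i, sum_smul_unitVec, hdΘ]
    exact hNe
  -- The maximum may occur at τ = t₀, so only the derivative from the left is tested.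
  have htime : HasDerivWithinAt (fun τ' => Z (y, σ, τ'))
      (∑ i, ∑ j, a i j * N i j + 2 * M / t₀) (Set.Icc 0 τ) τ := by
    have h1 := hu.equation (y + σ • e) τ hτT
    have h2 := hu.equation y τ hτT
    rw [hz2] at h1
    rw [hz1] at h2
    have h3 : HasDerivWithinAt (fun τ' : ℝ => 2 * M * (1 - τ' / t₀)) (-(2 * M / t₀))
        (Set.Icc 0 T) τ := by
      refine ((((hasDerivAt_id τ).div_const t₀).const_sub 1).const_mul
        (2 * M)).hasDerivWithinAt.congr_deriv ?_
      ring
    refine ((((h1.sub h2).sub_const (Θ σ)).sub h3).congr_deriv ?_).mono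
      (Set.Icc_subset_Icc_right hτT.2)
    simp only [ha, hNdef, mul_sub, Finset.sum_sub_distrib]
    ring
  have hfin := nonneg_of_hasDerivWithinAt_left hτ0 htime fun τ' hτ' =>
    hmax y σ τ' hσ ⟨hτ'.1, hτ'.2.trans hτ.2⟩
  -- The choice b = M/(c t₀) makes the spatial term twice as large as the time term 2M/t₀.
  have hlast : c / d ^ 2 * ∑ i, ∑ j, e i * e j * N i j ≤ -(4 * (M / t₀)) := by
    calc c / d ^ 2 * ∑ i, ∑ j, e i * e j * N i j ≤ c / d ^ 2 * (4 * (-b * d ^ 2)) := by gcongr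
      _ = -(4 * (M / t₀)) := by
        have : d ≠ 0 := by positivity
        rw [hb]
        field_simp
  have h4 : 0 < M / t₀ := by positivity
  have h5 : 2 * M / t₀ = 2 * (M / t₀) := by ring
  linarith

/-- Interior gradient bound in a direction `e`. -/
lemma IsSolution.fderiv_le (hF : IsAreaIntegrand F) (hu : IsSolution φ F T u)
    (hper : IsSpatiallyPeriodic T u) {M c : ℝ} (hM : 0 < M) (hc : 0 < c) {e : Euc n}
    (hcoef : ∀ p : Fin n → ℝ, 1 ≤ ∑ i, p i * e i →
      ∀ v : Fin n → ℝ, c * (∑ i, e i * v i) ^ 2 ≤ (∑ i, p i * e i) ^ 2 *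
        (F ((∑ i, p i • φ i.succ) - φ 0) * hess F ((∑ i, p i • φ i.succ) - φ 0)
          (∑ i, v i • φ i.succ) (∑ i, v i • φ i.succ)))
    (hbd : ∀ x : Euc n, ∀ t ∈ Set.Icc 0 T, |u x t| ≤ M) {t : ℝ} (ht : 0 < t) (htT : t ≤ T)
    (x : Euc n) : fderiv ℝ (fun y => u y t) x e ≤ Real.exp (2 * M ^ 2 / (c * t)) := by
  set b : ℝ := M / (c * t) with hb
  have hb0 : 0 < b := by positivity
  set G : ℝ := b * Real.exp (2 * M * b) with hG
  have hG0 : 0 < G := by positivity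
  set s₀ : ℝ := (Real.exp (2 * M * b) - 1) / G with hs₀
  have hs₀pos : 0 < s₀ := div_pos (sub_pos.2 (Real.one_lt_exp_iff.2 (by positivity))) hG0
  have hs₀eq : 1 + G * s₀ = Real.exp (2 * M * b) := by
    rw [hs₀, mul_div_cancel₀ _ hG0.ne']
    ring
  have hosc := hu.osc_le hF hper hM hc hcoef hbd ht htT hb hs₀eq x
  have hdiff : DifferentiableAt ℝ (fun y => u y t) (x + (0 : ℝ) • e) :=
    (hu.contDiff_slice ⟨ht.le, htT⟩).differentiable (by simp) _
  have h1 : HasDerivAt (fun s : ℝ => u (x + s • e) t - u x t - Real.log (1 + G * s) / b)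
      (fderiv ℝ (fun y => u y t) (x + (0 : ℝ) • e) e - G / (1 + G * 0) / b) 0 := by
    have h2 : HasDerivAt (fun s : ℝ => 1 + G * s) G 0 := by
      simpa using ((hasDerivAt_id (0 : ℝ)).const_mul G).const_add 1
    exact ((hasDerivAt_line hdiff).sub_const _).sub ((h2.log (by simp)).div_const b)
  -- At the final time the term 2M(1 - t/t₀) vanishes, so the difference is nonpositive on [0, s₀]
  -- with equality at s = 0.
  have h3 := nonpos_of_hasDerivWithinAt_right hs₀pos h1.hasDerivWithinAt fun s hs => by
    have := hosc s hs t ⟨ht.le, le_rfl⟩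
    rw [div_self ht.ne'] at this
    simp
    linarith
  have h4 : G / b = Real.exp (2 * M ^ 2 / (c * t)) := by
    rw [hG, mul_div_cancel_left₀ _ hb0.ne', hb]
    congr 1
    ring
  simp only [zero_smul, add_zero, mul_zero, div_one, h4] at h3
  linarith

/-! ### From the gradient bound to the stated estimate. -/

/-- Interior bound for the area integrand evaluated at the conormal. -/
lemma IsAreaIntegrand.exists_conormal_bound (hF : IsAreaIntegrand F)
    (φ : Module.Basis (Fin (n + 1)) ℝ (Euc (n + 1))) :
    ∃ c D : ℝ, 0 < c ∧ 1 ≤ D ∧ ∀ (M T : ℝ) (u : Euc n → ℝ → ℝ), 0 < M → IsSolution φ F T u →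
      (∀ x : Euc n, ∀ t ∈ Set.Icc 0 T, |u x t| ≤ M) → IsSpatiallyPeriodic T u →
      ∀ (x : Euc n) (t : ℝ), 0 < t → t ≤ T →
        F (conormal φ u x t) ≤ D * Real.exp (2 * M ^ 2 / (c * t)) := by
  obtain ⟨c, hc, hcoef⟩ := hF.exists_coeff_lower φ
  obtain ⟨m, B, -, hB, hmB⟩ := hF.exists_bounds
  -- The added 1 gives D ≥ 1, so that log D ≥ 0 later.
  refine ⟨c, B * ∑ j, ‖φ j‖ + 1, hc, by linarith [show 0 ≤ B * ∑ j, ‖φ j‖ by positivity],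
    fun M T u hM hu hbd hper x t ht htT => ?_⟩
  set E : ℝ := Real.exp (2 * M ^ 2 / (c * t)) with hE
  have hE1 : 1 ≤ E := Real.one_le_exp (by positivity)
  have hdir : ∀ e : Euc n, ‖e‖ = 1 → fderiv ℝ (fun y => u y t) x e ≤ E := fun e he =>
    hu.fderiv_le hF hper hM hc (fun p => hcoef p e he) hbd ht htT x
  have hpart : ∀ i, |partialX u x t i| ≤ E := fun i => by
    have h1 := hdir (unitVec i) (by simp [unitVec])
    have h2 := hdir (-unitVec i) (by simp [unitVec])
    rw [map_neg] at h2
    exact abs_le.2 ⟨by simp only [partialX]; linarith, h1⟩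
  have hz0 : conormal φ u x t ≠ 0 := fun h0 => by
    have : φ.repr (conormal φ u x t) 0 = -1 := by simp [conormal, Fin.succ_ne_zero]
    rw [h0] at this
    simp at this
  have hnorm : ‖conormal φ u x t‖ ≤ E * ∑ j, ‖φ j‖ := by
    rw [Fin.sum_univ_succ, mul_add, Finset.mul_sum, add_comm (E * ‖φ 0‖)]
    refine (norm_sub_le _ _).trans (add_le_add ((norm_sum_le _ _).trans ?_) ?_)
    · refine Finset.sum_le_sum fun i _ => ?_
      rw [norm_smul]
      exact mul_le_mul_of_nonneg_right (hpart i) (norm_nonneg _)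
    · exact le_mul_of_one_le_left (norm_nonneg _) hE1
  calc F (conormal φ u x t) ≤ B * ‖conormal φ u x t‖ := (hmB _ hz0).2
    _ ≤ B * (E * ∑ j, ‖φ j‖) := by gcongr
    _ ≤ (B * ∑ j, ‖φ j‖ + 1) * E := by linarith

/-- For short times the exponential barrier absorbs multiplicative constants. -/
lemma mul_exp_le_barrier {M c D t w : ℝ} (hM : 0 < M) (hc : 0 < c) (hD : 1 ≤ D) (ht : 0 < t)
    (ht2 : t ≤ M ^ 2) (ht4 : t ≤ M ^ 4 / 8) (hw : |w| ≤ M) :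
    D * Real.exp (2 * M ^ 2 / (c * t)) ≤
      t ^ ((2 : ℝ) / 2) * Real.exp ((1 + 2 * Real.log D + 4 / c) * 2 * (|w| - 2 * M) ^ 2 / (4 * t)) := by
  have hlog : 0 ≤ Real.log D := Real.log_nonneg hD
  have hD' : D ≤ Real.exp (Real.log D * (M ^ 2 / t)) := by
    calc D = Real.exp (Real.log D) := (Real.exp_log (by linarith)).symm
      _ ≤ _ := Real.exp_le_exp.2 (le_mul_of_one_le_right hlog ((one_le_div ht).2 ht2))
  have ht' : 1 ≤ t * Real.exp (M ^ 2 / (2 * t)) := by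
    have h1 : (M ^ 2 / (2 * t)) ^ 2 / 2 ≤ Real.exp (M ^ 2 / (2 * t)) := by
      have := Real.quadratic_le_exp_of_nonneg (show 0 ≤ M ^ 2 / (2 * t) by positivity)
      have h0 : 0 ≤ M ^ 2 / (2 * t) := by positivity
      linarith
    calc 1 ≤ M ^ 4 / 8 / t := (one_le_div ht).2 ht4
      _ = t * ((M ^ 2 / (2 * t)) ^ 2 / 2) := by field_simp; ring
      _ ≤ _ := by gcongr
  have hsq : M ^ 2 ≤ (|w| - 2 * M) ^ 2 := by nlinarith [abs_nonneg w]
  -- The three terms pay for D, the gradient bound and the factor t; the constant A is their exact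
  -- sum when (|w| - 2M)² = M².
  have hexp : Real.log D * (M ^ 2 / t) + 2 * M ^ 2 / (c * t) + M ^ 2 / (2 * t) ≤
      (1 + 2 * Real.log D + 4 / c) * 2 * (|w| - 2 * M) ^ 2 / (4 * t) := by
    calc Real.log D * (M ^ 2 / t) + 2 * M ^ 2 / (c * t) + M ^ 2 / (2 * t)
        = (1 + 2 * Real.log D + 4 / c) * 2 * M ^ 2 / (4 * t) := by field_simp; ring
      _ ≤ _ := by gcongr
  rw [div_self two_ne_zero, Real.rpow_one]
  calc D * Real.exp (2 * M ^ 2 / (c * t))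
      ≤ Real.exp (Real.log D * (M ^ 2 / t)) * Real.exp (2 * M ^ 2 / (c * t))
        * (t * Real.exp (M ^ 2 / (2 * t))) :=
        (mul_le_mul_of_nonneg_right hD' (Real.exp_pos _).le).trans
          (le_mul_of_one_le_right (by positivity) ht')
    _ = t * Real.exp (Real.log D * (M ^ 2 / t) + 2 * M ^ 2 / (c * t) + M ^ 2 / (2 * t)) := by
        rw [Real.exp_add, Real.exp_add]
        ring
    _ ≤ _ := by gcongr

lemma conormal_of_forall_eq_zero {t : ℝ} (h : ∀ x, u x t = 0) (x : Euc n) :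
    conormal φ u x t = -φ 0 := by
  simp [conormal, partialX, h]

end AnisotropicFlow

open AnisotropicFlow in
theorem theorem1 (n : ℕ) (hn : 1 ≤ n) :
    ∃ T' : ℝ → ℝ, (∀ M : ℝ, 0 < T' M) ∧
      ∀ (φ : Module.Basis (Fin (n + 1)) ℝ (Euc (n + 1))) (F : Euc (n + 1) → ℝ),
        IsAreaIntegrand F →
        ∀ C₁ : ℝ, 0 ≤ C₁ → C₁ ^ 2 < 4 / √(n : ℝ) → SmallThirdDerivatives F C₁ →
        ∃ A P q : ℝ, 0 < A ∧ 0 < P ∧ 1 < q ∧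
          ∀ (M T : ℝ) (u : Euc n → ℝ → ℝ),
            IsSolution φ F T u →
            (∀ x : Euc n, ∀ t ∈ Set.Icc 0 T, |u x t| ≤ M) →
            IsSpatiallyPeriodic T u →
            ∀ (x : Euc n) (t : ℝ), 0 < t → t ≤ T → t ≤ T' M →
              F (conormal φ u x t) ≤
                max (t ^ (q / 2) * Real.exp (A * q * (|u x t| - 2 * M) ^ 2 / (4 * t))) P := by
  -- The value 1 is arbitrary: for M < 0 the bound on u is contradictory, and for M = 0 it makes u
  -- vanish.
  refine ⟨fun M => if 0 < M then min (M ^ 2) (M ^ 4 / 8) else 1, fun M => ?_, ?_⟩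
  · dsimp only
    split_ifs with hM <;> positivity
  intro φ F hF C₁ _ _ _
  obtain ⟨c, D, hc, hD, hbound⟩ := hF.exists_conormal_bound φ
  have hlog : 0 ≤ Real.log D := Real.log_nonneg hD
  -- P is needed only for M = 0, where the conormal is -φ⁰; for M > 0 the exponential term alone
  -- suffices.
  refine ⟨1 + 2 * Real.log D + 4 / c, F (-φ 0), 2, by positivity,
    hF.pos _ (neg_ne_zero.2 (φ.ne_zero 0)), one_lt_two, ?_⟩
  intro M T u hu hbd hper x t ht htT htT'
  rcases lt_trichotomy M 0 with hM | rfl | hM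
  · linarith [hbd x t ⟨ht.le, htT⟩, abs_nonneg (u x t)]
  · refine le_max_of_le_right (le_of_eq ?_)
    rw [conormal_of_forall_eq_zero fun y =>
      abs_eq_zero.1 (le_antisymm (hbd y t ⟨ht.le, htT⟩) (abs_nonneg _))]
  · dsimp only at htT'
    rw [if_pos hM] at htT'
    exact le_max_of_le_left ((hbound M T u hM hu hbd hper x t ht htT).trans
      (mul_exp_le_barrier hM hc hD ht (htT'.trans (min_le_left _ _))
        (htT'.trans (min_le_right _ _)) (hbd x t ⟨ht.le, htT⟩)))
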